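/- Let $\mathcal S$ and $\mathcal A$ be finite sets (states and actions) and let $\Delta(\cdot)$ denote the probability simplex. Let $\mathcal P\subset\Delta(\mathcal S)^{\mathcal S\times\mathcal A}\subset\mathbb R^{\mathcal S\times\mathcal A\times\mathcal S}$ be an uncertainty set of transition probabilities $\boldsymbol P=(\boldsymbol P_{sa})_{s,a}$. A history at time $t$ is a sequence $h_t=(s_0,a_0,\dots,s_{t-1},a_{t-1},s_t)$. Let $\Pi_{\sf H}$ be the set of history-dependent policies, which map every history to an element of $\Delta(\mathcal A)$; let $\Pi_{\sf S}=\Delta(\mathcal A)^{\mathcal S}$ be the set of stationary policies; and let $\mathcal P_{\sf H}$ be the set of history-dependent adversaries, which map every history to an element of $\mathcal P$ (so $\mathcal P\subset\mathcal P_{\sf H}$ as the constant maps). For rewards $\boldsymbol r\in\mathbb R^{\mathcal S\times\mathcal A\times\mathcal S}$, a discount factor $\gamma\in[0,1)$, $\pi\in\Pi_{\sf H}$ and $\boldsymbol P\in\mathcal P_{\sf H}$, put $$v^{\pi,\boldsymbol P}_s=\mathbb E^{\pi,\boldsymbol P}\Big[\sum_{t=0}^{\infty}\gamma^t r_{s_ta_ts_{t+1}}\,\Big|\,s_0=s\Big],\qquad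 s\in\mathcal S,$$ where, given $h_t$, the action $a_t$ is drawn from $\pi(h_t)$ and then $s_{t+1}$ is drawn from $\boldsymbol P(h_t)_{s_ta_t}$. The set $\mathcal P$ is called weakly s-tractable if, for all $\pi\in\Pi_{\sf S}$, all rewards $\boldsymbol r$ that do not depend on the next state ($r_{sas'}=r_{sas''}$ for all $s,a,s',s''$), all $\gamma\in[0,1)$ and all $\boldsymbol\mu\in\Delta(\mathcal S)$, $$\min_{\boldsymbol P\in\mathcal P}\boldsymbol\mu^\top\boldsymbol v^{\pi,\boldsymbol P}=\boldsymbol\mu^\top\boldsymbol u^\pi,$$ where $\boldsymbol u^\pi\in\mathbb R^{\mathcal S}$ is the solution of $u^\pi_s=\min_{\boldsymbol P\in\mathcal P}\sum_{a}\pi_{sa}\boldsymbol P_{sa}^\top(\boldsymbol r_{sa}+\gamma\boldsymbol u^\pi)$ for all $s\in\mathcal S$. Theorem. Let $\mathcal P$ be compact, convex and weakly s-tractable. Let $\boldsymbol r$ be rewards that do not depend on the next state, $\gamma\in[0,1)$ and $\boldsymbol\mu\in\Delta(\mathcal S)$. Then for every $\pi\in\Pi_{\sf H}$ the minimum of $\boldsymbol\mu^\top\boldsymbol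 v^{\pi,\boldsymbol P}$ over $\boldsymbol P\in\mathcal P$ is attained, and $$\sup_{\pi\in\Pi_{\sf H}}\ \inf_{\boldsymbol P\in\mathcal P_{\sf H}}\boldsymbol\mu^\top\boldsymbol v^{\pi,\boldsymbol P}=\sup_{\pi\in\Pi_{\sf H}}\ \min_{\boldsymbol P\in\mathcal P}\boldsymbol\mu^\top\boldsymbol v^{\pi,\boldsymbol P}.$$ -/

import Mathlib

open MeasureTheory ProbabilityTheory

namespace RobustMDP

/-- The measure on a finite set with the given point weights. -/
noncomputable def finMeasure {ι : Type*} [Fintype ι] [MeasurableSpace ι] (p : ι → ℝ) :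
    Measure ι :=
  ∑ i, ENNReal.ofReal (p i) • Measure.dirac i

theorem isProbabilityMeasure_finMeasure {ι : Type*} [Fintype ι] [MeasurableSpace ι]
    {p : ι → ℝ} (hp : p ∈ stdSimplex ℝ ι) : IsProbabilityMeasure (finMeasure p) := by
  constructor
  simp [finMeasure, ← ENNReal.ofReal_sum_of_nonneg (fun i _ => hp.1 i), hp.2]

/-- All transition probabilities `(P_{sa})`, with `P_{sa}` in the simplex over `S`,
as a subset of the vector space of real arrays indexed by `S × A × S`. -/
abbrev TransitionProb (S A : Type*) [Fintype S] : Type _ :=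
  {P : S → A → S → ℝ // ∀ s a, P s a ∈ stdSimplex ℝ S}

/-- Histories `(s₀, a₀, …, s_{n-1}, a_{n-1}, s_n)` at time `n`: the state-action pairs of the
times before `n`, and the state at time `n`. -/
abbrev Hist (S A : Type*) (n : ℕ) : Type _ := (Fin n → S × A) × S

/-- History-dependent (randomized) policies of the decision-maker. -/
abbrev Policy (S A : Type*) [Fintype A] : Type _ :=
  ∀ n : ℕ, Hist S A n → stdSimplex ℝ A

/-- Stationary (randomized) policies of the decision-maker. -/
abbrev StationaryPolicy (S A : Type*) [Fintype A] : Type _ := S → stdSimplex ℝ A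

/-- A stationary policy, as a policy. -/
def StationaryPolicy.toPolicy {S A : Type*} [Fintype A] (π : StationaryPolicy S A) :
    Policy S A :=
  fun _ h => π h.2

/-- History-dependent transition probabilities: at time `n`, the transition probabilities in
force are a function of the history up to time `n` (which ends with the state at time `n`; the
action at time `n` is not observed). -/
abbrev HistTransition (S A : Type*) [Fintype S] : Type _ :=
  ∀ n : ℕ, Hist S A n → TransitionProb S A

/-- Stationary transition probabilities, as history-dependent ones. -/
def TransitionProb.toHist {S A : Type*} [Fintype S] (P : TransitionProb S A) :
    HistTransition S A :=
  fun _ _ => P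

/-- The history-dependent adversaries with values in the uncertainty set `U`. -/
def historyAdversaries {S A : Type*} [Fintype S] (U : Set (TransitionProb S A)) :
    Set (HistTransition S A) :=
  {Q | ∀ n h, Q n h ∈ U}

section Trajectories

variable {S A : Type*}

/-- The history at time `n` read off the state-action pairs of the times `0, …, n`. -/
def histOf {n : ℕ} (x : Finset.Iic n → S × A) : Hist S A n :=
  (fun i => x ⟨i, Finset.mem_Iic.2 i.2.le⟩, (x ⟨n, Finset.mem_Iic.2 le_rfl⟩).1)

/-- The history at time `n + 1` made of the state-action pairs of the times `0, …, n` and of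
the state `s` at time `n + 1`. -/
def histSnoc {n : ℕ} (x : Finset.Iic n → S × A) (s : S) : Hist S A (n + 1) :=
  (fun i => x ⟨i, Finset.mem_Iic.2 (Nat.lt_succ_iff.1 i.2)⟩, s)

/-- The action at time `n`, given the state-action pairs of the times `0, …, n`. -/
def lastAction {n : ℕ} (x : Finset.Iic n → S × A) : A :=
  (x ⟨n, Finset.mem_Iic.2 le_rfl⟩).2

variable [Fintype S] [Fintype A]

/-- The joint weights of `(s_{n+1}, a_{n+1})` given the past `x`: the state is drawn from the
transition probabilities chosen at time `n`, at the state and action of time `n`, and then the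
action is drawn from the policy. -/
def stepWeight (π : Policy S A) (Q : HistTransition S A) {n : ℕ}
    (x : Finset.Iic n → S × A) (y : S × A) : ℝ :=
  (Q n (histOf x)).1 (histOf x).2 (lastAction x) y.1 * (π (n + 1) (histSnoc x y.1)).1 y.2

theorem stepWeight_mem (π : Policy S A) (Q : HistTransition S A) {n : ℕ}
    (x : Finset.Iic n → S × A) : stepWeight π Q x ∈ stdSimplex ℝ (S × A) := by
  have hP := (Q n (histOf x)).2 (histOf x).2 (lastAction x)
  refine ⟨fun y => mul_nonneg (hP.1 _) ((π (n + 1) (histSnoc x y.1)).2.1 _), ?_⟩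
  simp only [Fintype.sum_prod_type, stepWeight, ← Finset.mul_sum]
  rw [← hP.2]
  exact Finset.sum_congr rfl fun s _ => by
    rw [(π (n + 1) (histSnoc x s)).2.2, mul_one]

variable [MeasurableSpace S] [MeasurableSpace A]
  [MeasurableSingletonClass S] [MeasurableSingletonClass A]

/-- The conditional law of `(s_{n+1}, a_{n+1})` given `(s₀, a₀, …, s_n, a_n)`. -/
noncomputable def stepKernel (π : Policy S A) (Q : HistTransition S A) (n : ℕ) :
    Kernel (Finset.Iic n → S × A) (S × A) :=
  Kernel.ofFunOfCountable fun x => finMeasure (stepWeight π Q x)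

instance (π : Policy S A) (Q : HistTransition S A) (n : ℕ) :
    IsMarkovKernel (stepKernel π Q n) :=
  ⟨fun x => isProbabilityMeasure_finMeasure (stepWeight_mem π Q x)⟩

/-- The law of `(s₀, a₀)` when the initial state is `s`. -/
noncomputable def initLaw (π : Policy S A) (s : S) : Measure (S × A) :=
  (finMeasure (π 0 (Fin.elim0, s)).1).map (fun a => (s, a))

/-- The law of the trajectory `(s_t, a_t)_t` started from the state `s` (the measure given by
the Ionescu-Tulcea theorem). -/
noncomputable def trajLaw (π : Policy S A) (Q : HistTransition S A) (s : S) :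
    Measure (ℕ → S × A) :=
  Kernel.trajMeasure (X := fun _ => S × A) (initLaw π s) (stepKernel π Q)

/-- The value function: the expectation of `∑ₜ γ ^ t * r s_t a_t s_{t+1}` given `s₀ = s`. -/
noncomputable def value (r : S → A → S → ℝ) (γ : ℝ) (π : Policy S A)
    (Q : HistTransition S A) (s : S) : ℝ :=
  ∫ ω, ∑' t : ℕ, γ ^ t * r (ω t).1 (ω t).2 (ω (t + 1)).1 ∂(trajLaw π Q s)

/-- The expected return `μᵀ v` from the initial distribution `μ`. -/
noncomputable def expectedReturn (r : S → A → S → ℝ) (γ : ℝ) (μ : S → ℝ) (π : Policy S A)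
    (Q : HistTransition S A) : ℝ :=
  ∑ s, μ s * value r γ π Q s

/-- The rewards do not depend on the next state. -/
def NextStateIndependent (r : S → A → S → ℝ) : Prop :=
  ∀ s a s' s'', r s a s' = r s a s''

/-- The vector `u` is the fixed point of the operator
`T^π(u)_s = min_{P ∈ U} ∑_a π_{sa} P_{sa}ᵀ (r_{sa} + γ u)`. -/
def IsRobustFixedPoint (U : Set (TransitionProb S A)) (r : S → A → S → ℝ) (γ : ℝ)
    (π : StationaryPolicy S A) (u : S → ℝ) : Prop :=
  ∀ s, IsLeast ((fun P : TransitionProb S A =>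
    ∑ a, (π s).1 a * ∑ s', P.1 s a s' * (r s a s' + γ * u s')) '' U) (u s)

/-- Weak s-tractability of `U`: for every stationary policy, rewards that do not depend on the
next state, discount factor and initial distribution, the worst-case return over `U` is attained
and equals `μᵀ u^π`, for the fixed point `u^π` of `T^π`. -/
def WeaklySTractable (U : Set (TransitionProb S A)) : Prop :=
  ∀ (π : StationaryPolicy S A) (r : S → A → S → ℝ), NextStateIndependent r →
    ∀ γ : ℝ, 0 ≤ γ → γ < 1 → ∀ μ ∈ stdSimplex ℝ S,
      ∃ u : S → ℝ, IsRobustFixedPoint U r γ π u ∧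
        IsLeast ((fun P : TransitionProb S A =>
          expectedReturn r γ μ π.toPolicy P.toHist) '' U) (∑ s, μ s * u s)

end Trajectories

end RobustMDP

/-!
Since the stationary elements of `U` are history-dependent adversaries, the left-hand side is at
most the right-hand side. Equality follows from a vector `u`, a stationary policy `π₀` and an
element `P₀` of `U` such that, in the one-step games with continuation `u`, the policy `π₀`
guarantees at least `u s` at every state `s` against every element of `U`, while against `P₀` no
action earns more than `u s` (`IsStatewiseSaddle`). Indeed sub- and supersolutions of the Bellman
equation along all histories bound the value function from below and above (`le_value`,
`value_le`), so `π₀` secures `μᵀ u` against every history-dependent adversary, and `P₀` holds every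
history-dependent policy down to `μᵀ u`.

What weak s-tractability provides is that for every stationary policy and every continuation, a
single element of `U` minimizes the one-step returns at all states at once
(`WeaklySTractable.exists_forall_lookahead_le`): with suitable rewards, any given continuation is
the robust value function of the policy, and then a worst case for the uniform initial distribution
is a worst case in every component. By Sion's minimax theorem, the sum over the states of the
one-step returns has a saddle point, and the simultaneous minimizer shows that it is a saddle
point at each state (`WeaklySTractable.exists_isStatewiseSaddle`). The resulting values are a
contraction in the continuation, and `u` is its fixed point.

The minimum over `U` is attained for every policy because the return is a uniformly convergent
series of functions continuous in the transition probabilities (`continuous_expectedReturn`).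
-/

namespace RobustMDP

/-! ### One-step returns -/

/-- The one-step return at the state `s`, when the action is drawn from `p`, the next state from
`P`, and the continuation is worth `u`. -/
def lookahead {S A : Type*} [Fintype S] [Fintype A] (r : S → A → S → ℝ) (γ : ℝ) (u : S → ℝ)
    (p : A → ℝ) (P : A → S → ℝ) (s : S) : ℝ :=
  ∑ a, p a * ∑ s', P a s' * (r s a s' + γ * u s')

theorem exists_abs_reward_le {S A : Type*} [Fintype S] [Fintype A] (r : S → A → S → ℝ) :
    ∃ R : ℝ, 0 ≤ R ∧ ∀ s a s', |r s a s'| ≤ R :=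
  ⟨∑ s, ∑ a, ∑ s', |r s a s'|, by positivity, fun s a s' => by
    calc |r s a s'| ≤ ∑ s', |r s a s'| :=
          Finset.single_le_sum (f := fun s' => |r s a s'|) (fun _ _ => abs_nonneg _)
            (Finset.mem_univ s')
      _ ≤ ∑ a, ∑ s', |r s a s'| :=
          Finset.single_le_sum (f := fun a => ∑ s', |r s a s'|) (fun _ _ => by positivity)
            (Finset.mem_univ a)
      _ ≤ _ := Finset.single_le_sum (f := fun s => ∑ a, ∑ s', |r s a s'|)
            (fun _ _ => by positivity) (Finset.mem_univ s)⟩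

/-! ### Integration along trajectories -/

theorem integral_finMeasure {ι : Type*} [Fintype ι] [MeasurableSpace ι]
    [MeasurableSingletonClass ι] {p : ι → ℝ} (hp : ∀ i, 0 ≤ p i) (f : ι → ℝ) :
    ∫ i, f i ∂finMeasure p = ∑ i, p i * f i := by
  rw [finMeasure, integral_finsetSum_measure fun i _ => Integrable.of_finite.smul_measure
    ENNReal.ofReal_ne_top]
  simp [integral_smul_measure, integral_dirac, ENNReal.toReal_ofReal (hp _)]

section Trajectories

variable {S A : Type*} [Fintype S] [Fintype A] [MeasurableSpace S] [MeasurableSpace A]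
  [MeasurableSingletonClass S] [MeasurableSingletonClass A]

instance isProbabilityMeasure_initLaw (π : Policy S A) (s : S) :
    IsProbabilityMeasure (initLaw π s) := by
  have := isProbabilityMeasure_finMeasure (π 0 (Fin.elim0, s)).2
  exact Measure.isProbabilityMeasure_map Measurable.of_discrete.aemeasurable

instance isProbabilityMeasure_trajLaw (π : Policy S A) (Q : HistTransition S A) (s : S) :
    IsProbabilityMeasure (trajLaw π Q s) := by
  unfold trajLaw; infer_instance

theorem integrable_comp_frestrictLe (π : Policy S A) (Q : HistTransition S A) (s : S) {n : ℕ}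
    (f : (Finset.Iic n → S × A) → ℝ) :
    Integrable (fun ω => f (Preorder.frestrictLe n ω)) (trajLaw π Q s) :=
  Integrable.comp_measurable (g := f) Integrable.of_finite (Preorder.measurable_frestrictLe n)

/-- The first state-action pair has the law `initLaw π s`. -/
theorem integral_trajLaw_zero (π : Policy S A) (Q : HistTransition S A) (s : S)
    (f : (Finset.Iic 0 → S × A) → ℝ) :
    ∫ ω, f (Preorder.frestrictLe 0 ω) ∂trajLaw π Q s =
      ∑ a, (π 0 (Fin.elim0, s)).1 a * f fun _ => (s, a) := by
  have hmap : (trajLaw π Q s).map (Preorder.frestrictLe (π := fun _ => S × A) 0) =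
      (initLaw π s).map (MeasurableEquiv.piUnique fun _ : Finset.Iic 0 => S × A).symm := by
    rw [trajLaw, Kernel.trajMeasure, Measure.map_comp _ _ (by fun_prop),
      Kernel.traj_map_frestrictLe, Kernel.partialTraj_self, Measure.id_comp]
  refine (integral_map (f := f)
    (Preorder.measurable_frestrictLe (X := fun _ => S × A) 0).aemeasurable
    Measurable.of_discrete.aestronglyMeasurable).symm.trans ?_
  rw [hmap, integral_map (by fun_prop) Measurable.of_discrete.aestronglyMeasurable, initLaw,
    integral_map Measurable.of_discrete.aemeasurable Measurable.of_discrete.aestronglyMeasurable,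
    integral_finMeasure (π 0 (Fin.elim0, s)).2.1]
  rfl

/-- The state-action pair at time `n + 1` has the conditional weights `stepWeight`
given the past. -/
theorem integral_trajLaw_succ (π : Policy S A) (Q : HistTransition S A) (s : S) {n : ℕ}
    (f : (Finset.Iic n → S × A) → S × A → ℝ) :
    ∫ ω, f (Preorder.frestrictLe n ω) (ω (n + 1)) ∂trajLaw π Q s =
      ∫ ω, ∑ y, stepWeight π Q (Preorder.frestrictLe n ω) y * f (Preorder.frestrictLe n ω) y
        ∂trajLaw π Q s := by
  have hcomp : (trajLaw π Q s).map (Preorder.frestrictLe n) ⊗ₘ stepKernel π Q n =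
      (trajLaw π Q s).map (fun x ↦ (Preorder.frestrictLe n x, x (n + 1))) :=
    Kernel.map_frestrictLe_trajMeasure_compProd_eq_map_trajMeasure
  have hf : ∀ x, ∫ y, f x y ∂stepKernel π Q n x = ∑ y, stepWeight π Q x y * f x y := fun x =>
    integral_finMeasure (stepWeight_mem π Q x).1 _
  have hprob : IsProbabilityMeasure
      ((trajLaw π Q s).map (Preorder.frestrictLe (π := fun _ => S × A) n)) :=
    Measure.isProbabilityMeasure_map (Preorder.measurable_frestrictLe n).aemeasurable
  have h := Measure.integral_compProd (f := fun p : _ × (S × A) => f p.1 p.2)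
    (Integrable.of_finite (μ := (trajLaw π Q s).map (Preorder.frestrictLe n) ⊗ₘ
      stepKernel π Q n))
  rw [hcomp, integral_map (by fun_prop) Measurable.of_discrete.aestronglyMeasurable,
    integral_map (Preorder.measurable_frestrictLe n).aemeasurable
      Measurable.of_discrete.aestronglyMeasurable] at h
  simpa only [hf] using h

/-- The action at time `n` is drawn from the policy, given the history at time `n`. -/
theorem integral_action (π : Policy S A) (Q : HistTransition S A) (s : S) (n : ℕ)
    (g : Hist S A n → A → ℝ) :
    ∫ ω, g (histOf (Preorder.frestrictLe n ω)) (ω n).2 ∂trajLaw π Q s =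
      ∫ ω, ∑ a, (π n (histOf (Preorder.frestrictLe n ω))).1 a *
        g (histOf (Preorder.frestrictLe n ω)) a ∂trajLaw π Q s := by
  cases n with
  | zero =>
    have hist : ∀ a : A, histOf (fun _ : Finset.Iic 0 => (s, a)) = (Fin.elim0, s) := fun a =>
      Prod.ext (funext fun i => i.elim0) rfl
    have h₁ := integral_trajLaw_zero π Q s fun x => g (histOf x) (lastAction x)
    have h₂ := integral_trajLaw_zero π Q s fun x => ∑ a, (π 0 (histOf x)).1 a * g (histOf x) a
    refine h₁.trans (Eq.trans ?_ h₂.symm)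
    simp only [hist, lastAction, ← Finset.sum_mul, (π 0 (Fin.elim0, s)).2.2, one_mul]
  | succ n =>
    have h₁ := integral_trajLaw_succ π Q s fun (x : Finset.Iic n → S × A) y =>
      g (histSnoc x y.1) y.2
    have h₂ := integral_trajLaw_succ π Q s fun (x : Finset.Iic n → S × A) y =>
      ∑ a, (π (n + 1) (histSnoc x y.1)).1 a * g (histSnoc x y.1) a
    refine h₁.trans (Eq.trans ?_ h₂.symm)
    congr 1 with ω
    simp only [Fintype.sum_prod_type, stepWeight, mul_assoc, ← Finset.mul_sum]
    refine Finset.sum_congr rfl fun s' _ => ?_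
    rw [← Finset.sum_mul, (π (n + 1) (histSnoc _ s')).2.2, one_mul]

/-- The state at time `n + 1` is drawn from the transition probabilities in force, and the action
at time `n` from the policy, given the history at time `n`. -/
theorem integral_transition (π : Policy S A) (Q : HistTransition S A) (s : S) (n : ℕ)
    (g : S → A → S → ℝ) :
    ∫ ω, g (ω n).1 (ω n).2 (ω (n + 1)).1 ∂trajLaw π Q s =
      ∫ ω, (fun h : Hist S A n => ∑ a, (π n h).1 a * ∑ s', (Q n h).1 h.2 a s' * g h.2 a s')
        (histOf (Preorder.frestrictLe n ω)) ∂trajLaw π Q s := by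
  have h₁ := integral_trajLaw_succ π Q s fun (x : Finset.Iic n → S × A) y =>
    g (histOf x).2 (lastAction x) y.1
  have h₂ := integral_action π Q s n fun h a => ∑ s', (Q n h).1 h.2 a s' * g h.2 a s'
  refine h₁.trans (Eq.trans ?_ h₂)
  congr 1 with ω
  simp only [Fintype.sum_prod_type, stepWeight, ← Finset.sum_mul, ← Finset.mul_sum]
  simp only [(π (n + 1) _).2.2, mul_one]
  rfl

/-! ### The value as a discounted sum, and Bellman inequalities -/

theorem integrable_transition (π : Policy S A) (Q : HistTransition S A) (s : S) (n : ℕ)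
    (g : S → A → S → ℝ) :
    Integrable (fun ω => g (ω n).1 (ω n).2 (ω (n + 1)).1) (trajLaw π Q s) :=
  integrable_comp_frestrictLe π Q s (n := n + 1) fun x =>
    g (x ⟨n, by simp⟩).1 (x ⟨n, by simp⟩).2 (x ⟨n + 1, by simp⟩).1

theorem abs_integral_transition_le (π : Policy S A) (Q : HistTransition S A) (s : S) (n : ℕ)
    {g : S → A → S → ℝ} {R : ℝ} (hR : ∀ s a s', |g s a s'| ≤ R) :
    |∫ ω, g (ω n).1 (ω n).2 (ω (n + 1)).1 ∂trajLaw π Q s| ≤ R := by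
  simpa using norm_integral_le_of_norm_le_const (μ := trajLaw π Q s) (C := R)
    (f := fun ω => g (ω n).1 (ω n).2 (ω (n + 1)).1) (.of_forall fun ω => hR _ _ _)

/-- The expectation may be exchanged with the discounted sum. -/
theorem hasSum_value (r : S → A → S → ℝ) {γ : ℝ} (hγ0 : 0 ≤ γ) (hγ1 : γ < 1) (π : Policy S A)
    (Q : HistTransition S A) (s : S) :
    HasSum (fun t : ℕ => γ ^ t * ∫ ω, r (ω t).1 (ω t).2 (ω (t + 1)).1 ∂trajLaw π Q s)
      (value r γ π Q s) := by
  obtain ⟨R, -, hR⟩ := exists_abs_reward_le r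
  have h := hasSum_integral_of_summable_integral_norm (μ := trajLaw π Q s)
    (F := fun t ω => γ ^ t * r (ω t).1 (ω t).2 (ω (t + 1)).1)
    (fun t => (integrable_transition π Q s t r).const_mul _) ?_
  · simp only [integral_const_mul] at h
    exact h
  · refine Summable.of_nonneg_of_le (fun t => by positivity) (fun t => ?_)
      ((summable_geometric_of_lt_one hγ0 hγ1).mul_right R)
    simp only [norm_mul, norm_pow, Real.norm_of_nonneg hγ0, integral_const_mul]
    gcongr
    exact (le_abs_self _).trans
      (abs_integral_transition_le π Q s t (g := fun s a s' => ‖r s a s'‖) (by simpa using hR))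

/-- A subsolution of the Bellman equation along all histories lies below the value function. -/
theorem le_value {r : S → A → S → ℝ} {γ : ℝ} (hγ0 : 0 ≤ γ) (hγ1 : γ < 1) {π : Policy S A}
    {Q : HistTransition S A} {u : S → ℝ}
    (h : ∀ n (x : Hist S A n),
      u x.2 ≤ lookahead r γ u (π n x).1 ((Q n x).1 x.2) x.2) (s : S) :
    u s ≤ value r γ π Q s := by
  set c : ℕ → ℝ := fun t => ∫ ω, r (ω t).1 (ω t).2 (ω (t + 1)).1 ∂trajLaw π Q s with hc
  set w : ℕ → ℝ := fun t => ∫ ω, u (ω t).1 ∂trajLaw π Q s with hw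
  have hu : ∀ s, |u s| ≤ ∑ s, |u s| := fun s =>
    Finset.single_le_sum (f := fun s => |u s|) (fun _ _ => abs_nonneg _) (Finset.mem_univ s)
  have hstep : ∀ t, w t ≤ c t + γ * w (t + 1) := by
    intro t
    have h₁ := integral_transition π Q s t fun s a s' => r s a s' + γ * u s'
    rw [integral_add (integrable_transition π Q s t r)
      (integrable_transition π Q s t fun _ _ s' => γ * u s'), integral_const_mul] at h₁
    rw [hc, hw]
    dsimp only
    rw [h₁]
    exact integral_mono
      (integrable_comp_frestrictLe π Q s (n := t) fun x => u (histOf x).2)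
      (integrable_comp_frestrictLe π Q s (n := t) fun x =>
        (fun h : Hist S A t => lookahead r γ u (π t h).1 ((Q t h).1 h.2) h.2) (histOf x))
      fun ω => h t (histOf (Preorder.frestrictLe t ω))
  have hzero : w 0 = u s := by
    have := integral_trajLaw_zero π Q s fun x => u (histOf x).2
    refine this.trans ?_
    simp only [histOf, ← Finset.sum_mul, (π 0 (Fin.elim0, s)).2.2, one_mul]
  -- `u s` is at most the return of the first `n` stages plus the discounted continuation `w n`.
  have hpartial : ∀ n, u s ≤ ∑ t ∈ Finset.range n, γ ^ t * c t + γ ^ n * w n := by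
    intro n
    induction n with
    | zero => simp [hzero]
    | succ n ih =>
      rw [Finset.sum_range_succ]
      have := mul_le_mul_of_nonneg_left (hstep n) (pow_nonneg hγ0 n)
      rw [pow_succ]
      linarith
  have hlim : Filter.Tendsto (fun n => γ ^ n * w n) Filter.atTop (nhds 0) := by
    refine squeeze_zero_norm (a := fun n => γ ^ n * ∑ s, |u s|) (fun n => ?_) ?_
    · rw [norm_mul, norm_pow, Real.norm_of_nonneg hγ0]
      gcongr
      simpa using norm_integral_le_of_norm_le_const (μ := trajLaw π Q s)
        (f := fun ω => u (ω n).1) (.of_forall fun ω => hu _)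
    · simpa using (tendsto_pow_atTop_nhds_zero_of_lt_one hγ0 hγ1).mul_const (∑ s, |u s|)
  have := ((hasSum_value r hγ0 hγ1 π Q s).tendsto_sum_nat).add hlim
  rw [add_zero] at this
  exact ge_of_tendsto' this hpartial

/-- A supersolution of the Bellman equation along all histories lies above the value function. -/
theorem value_le {r : S → A → S → ℝ} {γ : ℝ} (hγ0 : 0 ≤ γ) (hγ1 : γ < 1) {π : Policy S A}
    {Q : HistTransition S A} {u : S → ℝ}
    (h : ∀ n (x : Hist S A n),
      lookahead r γ u (π n x).1 ((Q n x).1 x.2) x.2 ≤ u x.2) (s : S) :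
    value r γ π Q s ≤ u s := by
  have hneg : value (fun s a s' => -r s a s') γ π Q s = -value r γ π Q s := by
    simp only [value, mul_neg, tsum_neg, integral_neg]
  have := le_value (r := fun s a s' => -r s a s') (u := fun s => -u s) hγ0 hγ1 (π := π) (Q := Q)
    (fun n x => ?_) s
  · linarith
  · have hx := neg_le_neg (h n x)
    refine hx.trans_eq ?_
    simp only [lookahead, ← Finset.sum_neg_distrib, ← mul_neg, neg_add]

/-! ### Continuity of the return in the transition probabilities -/

theorem continuous_integral_frestrictLe (π : Policy S A) (s : S) (n : ℕ)
    (f : TransitionProb S A → (Finset.Iic n → S × A) → ℝ) (hf : ∀ x, Continuous fun P => f P x) :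
    Continuous fun P : TransitionProb S A =>
      ∫ ω, f P (Preorder.frestrictLe n ω) ∂trajLaw π P.toHist s := by
  induction n with
  | zero =>
    simp only [integral_trajLaw_zero]
    exact continuous_finsetSum _ fun a _ => (hf _).const_mul _
  | succ n ih =>
    -- A trajectory up to time `n + 1` is glued from the one up to time `n` and the last pair.
    let glue : (Finset.Iic n → S × A) → S × A → (Finset.Iic (n + 1) → S × A) := fun x y i =>
      if hi : i.1 ≤ n then x ⟨i.1, Finset.mem_Iic.2 hi⟩ else y
    have hglue : ∀ ω : ℕ → S × A,
        glue (Preorder.frestrictLe n ω) (ω (n + 1)) = Preorder.frestrictLe (n + 1) ω := by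
      intro ω
      funext i
      have := Finset.mem_Iic.1 i.2
      by_cases hi : i.1 ≤ n
      · simp [glue, hi]
      · have : i.1 = n + 1 := by omega
        simp [glue, this]
    simp only [← hglue]
    simp only [fun P => integral_trajLaw_succ π (TransitionProb.toHist P) s
      fun x y => f P (glue x y)]
    refine ih (fun P x => ∑ y, stepWeight π P.toHist x y * f P (glue x y)) fun x =>
      continuous_finsetSum _ fun y _ => Continuous.mul ?_ (hf _)
    have : Continuous fun P : TransitionProb S A => P.1 (histOf x).2 (lastAction x) y.1 := by
      have := continuous_subtype_val (p := fun P : S → A → S → ℝ => ∀ s a, P s a ∈ stdSimplex ℝ S)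
      exact continuous_apply_apply (lastAction x) y.1 |>.comp
        ((continuous_apply (histOf x).2).comp this)
    exact this.mul_const _

theorem continuous_value {r : S → A → S → ℝ} {γ : ℝ} (hγ0 : 0 ≤ γ) (hγ1 : γ < 1)
    (π : Policy S A) (s : S) :
    Continuous fun P : TransitionProb S A => value r γ π P.toHist s := by
  obtain ⟨R, -, hR⟩ := exists_abs_reward_le r
  simp only [← (hasSum_value r hγ0 hγ1 π _ s).tsum_eq]
  refine continuous_tsum (u := fun t => γ ^ t * R) (fun t => Continuous.const_mul ?_ _)
    ((summable_geometric_of_lt_one hγ0 hγ1).mul_right R) fun t P => ?_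
  · exact continuous_integral_frestrictLe π s (t + 1)
      (fun _ x => r (x ⟨t, by simp⟩).1 (x ⟨t, by simp⟩).2 (x ⟨t + 1, by simp⟩).1)
      fun _ => continuous_const
  · rw [norm_mul, norm_pow, Real.norm_of_nonneg hγ0]
    gcongr
    exact abs_integral_transition_le π _ s t hR

theorem continuous_expectedReturn {r : S → A → S → ℝ} {γ : ℝ} (hγ0 : 0 ≤ γ) (hγ1 : γ < 1)
    (μ : S → ℝ) (π : Policy S A) :
    Continuous fun P : TransitionProb S A => expectedReturn r γ μ π P.toHist :=
  continuous_finsetSum _ fun s _ => (continuous_value hγ0 hγ1 π s).const_mul _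

end Trajectories

/-! ### Inequalities for one-step returns -/

section OneStep

variable {S A : Type*} [Fintype S] [Fintype A]

theorem lookahead_le_add {γ : ℝ} (hγ0 : 0 ≤ γ) {p : A → ℝ} (hp : p ∈ stdSimplex ℝ A)
    {P : A → S → ℝ} (hP : ∀ a, P a ∈ stdSimplex ℝ S) {u u' : S → ℝ} {c : ℝ}
    (h : ∀ s, u s ≤ u' s + c) (r : S → A → S → ℝ) (s : S) :
    lookahead r γ u p P s ≤ lookahead r γ u' p P s + γ * c := by
  have hinner : ∀ a, ∑ s', P a s' * (r s a s' + γ * u s') ≤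
      ∑ s', P a s' * (r s a s' + γ * u' s') + γ * c := fun a => by
    calc _ ≤ ∑ s', (P a s' * (r s a s' + γ * u' s') + P a s' * (γ * c)) := by
          refine Finset.sum_le_sum fun s' _ => ?_
          rw [← mul_add]
          refine mul_le_mul_of_nonneg_left ?_ ((hP a).1 s')
          have := mul_le_mul_of_nonneg_left (h s') hγ0
          linarith
      _ = _ := by rw [Finset.sum_add_distrib, ← Finset.sum_mul, (hP a).2, one_mul]
  calc _ ≤ ∑ a, (p a * ∑ s', P a s' * (r s a s' + γ * u' s') + p a * (γ * c)) := by
        refine Finset.sum_le_sum fun a _ => ?_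
        rw [← mul_add]
        exact mul_le_mul_of_nonneg_left (hinner a) (hp.1 a)
    _ = _ := by rw [Finset.sum_add_distrib, ← Finset.sum_mul, hp.2, one_mul, lookahead]

theorem lookahead_le_of_forall_le {p : A → ℝ} (hp : p ∈ stdSimplex ℝ A) {r : S → A → S → ℝ}
    {γ : ℝ} {u : S → ℝ} {P : A → S → ℝ} {s : S} {c : ℝ}
    (h : ∀ a, ∑ s', P a s' * (r s a s' + γ * u s') ≤ c) : lookahead r γ u p P s ≤ c := by
  calc _ ≤ ∑ a, p a * c := Finset.sum_le_sum fun a _ => mul_le_mul_of_nonneg_left (h a) (hp.1 a)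
    _ = c := by rw [← Finset.sum_mul, hp.2, one_mul]

/-- When the rewards do not depend on the next state, they decouple from the transitions. -/
theorem lookahead_eq {r : S → A → S → ℝ} (hr : NextStateIndependent r) (γ : ℝ) (u : S → ℝ)
    (p : A → ℝ) {P : A → S → ℝ} (hP : ∀ a, P a ∈ stdSimplex ℝ S) (s : S) :
    lookahead r γ u p P s = ∑ a, p a * r s a s + γ * ∑ a, p a * ∑ s', P a s' * u s' := by
  have : ∀ a, ∑ s', P a s' * (r s a s' + γ * u s') = r s a s + γ * ∑ s', P a s' * u s' :=
    fun a => by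
      simp only [hr s a _ s, mul_add, Finset.sum_add_distrib, ← Finset.sum_mul, (hP a).2, one_mul,
        Finset.mul_sum, mul_left_comm]
  simp only [lookahead, this]
  simp only [mul_add, Finset.sum_add_distrib, Finset.mul_sum, mul_left_comm]

theorem continuous_lookahead {X : Type*} [TopologicalSpace X] (r : S → A → S → ℝ) (γ : ℝ)
    (u : S → ℝ) {p : X → A → ℝ} {P : X → A → S → ℝ} (hp : Continuous p) (hP : Continuous P)
    (s : S) : Continuous fun x => lookahead r γ u (p x) (P x) s := by
  unfold lookahead
  fun_prop

/-- Two fixed points of the robust evaluation operator are comparable in both directions, hence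
equal. -/
theorem IsRobustFixedPoint.le {U : Set (TransitionProb S A)} {r : S → A → S → ℝ} {γ : ℝ}
    (hγ0 : 0 ≤ γ) (hγ1 : γ < 1) {π : StationaryPolicy S A} {u u' : S → ℝ}
    (h : IsRobustFixedPoint U r γ π u) (h' : IsRobustFixedPoint U r γ π u') : u ≤ u' := by
  cases isEmpty_or_nonempty S
  · exact fun s => isEmptyElim s
  obtain ⟨s₀, hs₀⟩ := Finite.exists_max fun s => u s - u' s
  obtain ⟨P, hP, hPu⟩ := (h' s₀).1
  have h₁ : u s₀ ≤ lookahead r γ u (π s₀).1 (P.1 s₀) s₀ := (h s₀).2 ⟨P, hP, rfl⟩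
  have h₂ := lookahead_le_add hγ0 (π s₀).2 (P.2 s₀) (u := u) (u' := u') (c := u s₀ - u' s₀)
    (fun s => by linarith [hs₀ s]) r s₀
  have h₃ : lookahead r γ u' (π s₀).1 (P.1 s₀) s₀ = u' s₀ := hPu
  have h₄ : u s₀ - u' s₀ ≤ 0 := by nlinarith
  exact fun s => by linarith [hs₀ s]

/-- The pair `(π, P)` is a saddle point, with value `w s` at every state `s`, of the one-step games
with continuation `u`: the policy `π` guarantees `w` against `U`, and no action earns more than `w`
against `P`. -/
structure IsStatewiseSaddle (U : Set (TransitionProb S A)) (r : S → A → S → ℝ) (γ : ℝ)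
    (u w : S → ℝ) (π : StationaryPolicy S A) (P : TransitionProb S A) : Prop where
  mem : P ∈ U
  le_lookahead : ∀ P' ∈ U, ∀ s, w s ≤ lookahead r γ u (π s).1 (P'.1 s) s
  action_le : ∀ s a, ∑ s', P.1 s a s' * (r s a s' + γ * u s') ≤ w s

/-- The value of the one-step games is a contraction in the continuation. -/
theorem IsStatewiseSaddle.le_add {U : Set (TransitionProb S A)} {r : S → A → S → ℝ} {γ : ℝ}
    (hγ0 : 0 ≤ γ) {u u' w w' : S → ℝ}
    {π π' : StationaryPolicy S A} {P P' : TransitionProb S A}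
    (h : IsStatewiseSaddle U r γ u w π P) (h' : IsStatewiseSaddle U r γ u' w' π' P') {c : ℝ}
    (hc : ∀ s, u s ≤ u' s + c) (s : S) : w s ≤ w' s + γ * c :=
  (h.le_lookahead P' h'.mem s).trans <|
    (lookahead_le_add hγ0 (π s).2 (P'.2 s) hc r s).trans <|
      add_le_add_left (lookahead_le_of_forall_le (π s).2 (h'.action_le s)) _

end OneStep

/-! ### Simultaneous worst-case transitions -/

section Tractable

variable {S A : Type*} [Fintype S] [Fintype A] [MeasurableSpace S] [MeasurableSpace A]
  [MeasurableSingletonClass S] [MeasurableSingletonClass A] {U : Set (TransitionProb S A)}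

theorem WeaklySTractable.nonempty [Nonempty S] (htract : WeaklySTractable U)
    (π : StationaryPolicy S A) : U.Nonempty := by
  classical
  obtain ⟨u, hu, -⟩ := htract π (fun _ _ _ => 0) (fun _ _ _ _ => rfl) 0 le_rfl zero_lt_one _
    (single_mem_stdSimplex ℝ (Classical.arbitrary S))
  obtain ⟨P, hP, -⟩ := (hu (Classical.arbitrary S)).1
  exact ⟨P, hP⟩

/-- Weak s-tractability makes one element of `U` a worst case at all states at once. Rewards that
depend on the current state alone turn any given `u` into the robust value function of `π`; an
element of `U` that attains the worst-case return for the uniform initial distribution then attains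
the minimum in every component of the fixed point equation. -/
theorem WeaklySTractable.exists_forall_lookahead_le [Nonempty S] (htract : WeaklySTractable U)
    (hcompact : IsCompact U) {r : S → A → S → ℝ} (hr : NextStateIndependent r) {γ : ℝ}
    (hγ0 : 0 ≤ γ) (π : StationaryPolicy S A) (u : S → ℝ) :
    ∃ P ∈ U, ∀ P' ∈ U, ∀ s,
      lookahead r γ u (π s).1 (P.1 s) s ≤ lookahead r γ u (π s).1 (P'.1 s) s := by
  have hne := htract.nonempty π
  -- `l P s` is the part of the one-step return at `s` that depends on `P`, and `M s` minimizes it.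
  set l : TransitionProb S A → S → ℝ := fun P s => ∑ a, (π s).1 a * ∑ s', P.1 s a s' * u s' with hl
  have hlc : ∀ s, Continuous fun P => l P s := fun s => by
    have : Continuous fun P : S → A → S → ℝ => ∑ a, (π s).1 a * ∑ s', P s a s' * u s' := by
      fun_prop
    exact this.comp continuous_subtype_val
  choose M hMU hM using fun s => hcompact.exists_isMinOn hne (hlc s).continuousOn
  -- These rewards make `u` the robust fixed point of `π` for the discount factor `1 / 2`; any
  -- factor in `(0, 1)` would do, and `γ` itself may be `0`.
  set ρ : S → A → S → ℝ := fun s _ _ => u s - 1 / 2 * l (M s) s with hρ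
  have hlook : ∀ (P : TransitionProb S A) s,
      lookahead ρ (1 / 2) u (π s).1 (P.1 s) s = u s - 1 / 2 * l (M s) s + 1 / 2 * l P s := by
    intro P s
    rw [lookahead_eq (fun _ _ _ _ => rfl) _ _ _ (P.2 s), ← Finset.sum_mul, (π s).2.2, one_mul]
  have hfix : IsRobustFixedPoint U ρ (1 / 2) π u := by
    refine fun s => ⟨⟨M s, hMU s, (hlook (M s) s).trans (by ring)⟩, ?_⟩
    rintro _ ⟨P, hP, rfl⟩
    refine le_of_le_of_eq ?_ (hlook P s).symm
    have : l (M s) s ≤ l P s := hM s hP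
    linarith
  have hcard : (0 : ℝ) < Fintype.card S := Nat.cast_pos.2 Fintype.card_pos
  obtain ⟨v, hv, ⟨P, hP, hPv⟩, -⟩ := htract π ρ (fun _ _ _ _ => rfl) (1 / 2) (by norm_num)
    (by norm_num) (fun _ => (Fintype.card S : ℝ)⁻¹)
    ⟨fun _ => by positivity, by simp [hcard.ne']⟩
  obtain rfl : v = u := le_antisymm (hv.le (by norm_num) (by norm_num) hfix)
    (hfix.le (by norm_num) (by norm_num) hv)
  have hsub : ∀ s, v s ≤ lookahead ρ (1 / 2) v (π s).1 (P.1 s) s := fun s => (hv s).2 ⟨P, hP, rfl⟩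
  have hle : ∀ s, v s ≤ value ρ (1 / 2) π.toPolicy P.toHist s :=
    le_value (by norm_num) (by norm_num) fun n x => hsub x.2
  have heq : ∀ s, value ρ (1 / 2) π.toPolicy P.toHist s = v s := by
    simp only [expectedReturn, ← Finset.mul_sum] at hPv
    have h := (Finset.sum_eq_sum_iff_of_le fun s _ => hle s).1
      (mul_left_cancel₀ (inv_ne_zero hcard.ne') hPv).symm
    exact fun s => (h s (Finset.mem_univ s)).symm
  -- One more application of the Bellman operator of `P` gives a larger subsolution.
  have hle' : ∀ s, lookahead ρ (1 / 2) v (π s).1 (P.1 s) s ≤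
      value ρ (1 / 2) π.toPolicy P.toHist s := by
    refine le_value (by norm_num) (by norm_num) fun n x => ?_
    have := lookahead_le_add (γ := 1 / 2) (by norm_num) (π x.2).2 (P.2 x.2) (c := 0) (u := v)
      (u' := fun s => lookahead ρ (1 / 2) v (π s).1 (P.1 s) s)
      (fun s => by simpa using hsub s) ρ x.2
    rw [mul_zero, add_zero] at this
    exact this
  refine ⟨P, hP, fun P' hP' s => ?_⟩
  have h₁ : l P s ≤ l (M s) s := by
    have := hle' s
    rw [heq, hlook] at this
    linarith
  have h₂ : l (M s) s ≤ l P' s := hM s hP'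
  rw [lookahead_eq hr _ _ _ (P.2 s), lookahead_eq hr _ _ _ (P'.2 s)]
  exact add_le_add_right (mul_le_mul_of_nonneg_left (h₁.trans h₂) hγ0) _

/-! ### The robust optimality equation -/

/-- The minimax theorem for the sum over the states of the one-step returns; the simultaneous
worst-case transitions split the saddle point of the sum into saddle points at every state. -/
theorem WeaklySTractable.exists_isStatewiseSaddle [Nonempty S] [Nonempty A]
    (htract : WeaklySTractable U) (hcompact : IsCompact U)
    (hconvex : Convex ℝ ((fun P : TransitionProb S A => P.1) '' U))
    {r : S → A → S → ℝ} (hr : NextStateIndependent r) {γ : ℝ} (hγ0 : 0 ≤ γ) (u : S → ℝ) :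
    ∃ w π P, IsStatewiseSaddle U r γ u w π P := by
  classical
  set Y : Set (S → A → ℝ) := Set.univ.pi fun _ => stdSimplex ℝ A with hY
  have hpure : ∀ α : S → A, (fun s => Pi.single (α s) (1 : ℝ)) ∈ Y := fun α s _ =>
    single_mem_stdSimplex ℝ (α s)
  have hneU : U.Nonempty := htract.nonempty
    fun _ => ⟨_, single_mem_stdSimplex ℝ (Classical.arbitrary A)⟩
  set f : (S → A → S → ℝ) → (S → A → ℝ) → ℝ := fun P p => ∑ s, lookahead r γ u (p s) (P s) s
    with hf
  have hlinP : ∀ p, IsLinearMap ℝ fun P => f P p := fun p =>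
    ⟨fun P P' => by
      simp only [hf, lookahead, Pi.add_apply, add_mul _ _ (_ + _), Finset.sum_add_distrib,
        mul_add (_ : ℝ) (∑ _, _)],
    fun c P => by
      simp only [hf, lookahead, Pi.smul_apply, smul_eq_mul, Finset.mul_sum, mul_assoc,
        mul_left_comm]⟩
  have hlinp : ∀ P, IsLinearMap ℝ fun p => f P p := fun P =>
    ⟨fun p p' => by
      simp only [hf, lookahead, Pi.add_apply, add_mul, Finset.sum_add_distrib],
    fun c p => by
      simp only [hf, lookahead, Pi.smul_apply, smul_eq_mul, Finset.mul_sum, mul_assoc,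
        mul_left_comm]⟩
  have hconvY : Convex ℝ Y := convex_pi fun _ _ => convex_stdSimplex ℝ A
  have hcontP : ∀ p, Continuous fun P => f P p := fun p =>
    continuous_finsetSum _ fun s _ =>
      continuous_lookahead r γ u continuous_const (continuous_apply s) s
  have hcontp : ∀ P, Continuous fun p => f P p := fun P =>
    continuous_finsetSum _ fun s _ =>
      continuous_lookahead r γ u (continuous_apply s) continuous_const s
  obtain ⟨_, ⟨P, hP, rfl⟩, p, hp, hsaddle⟩ := Sion.exists_isSaddlePointOn (f := f)
    (hneU.image _) hconvex (hcompact.image continuous_subtype_val)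
    (fun p _ => (hcontP p).lowerSemicontinuous.lowerSemicontinuousOn _)
    (fun p _ => ((hlinP p).mk' _ |>.convexOn hconvex).quasiconvexOn)
    hconvY ⟨_, hpure fun _ => Classical.arbitrary A⟩
    (isCompact_univ_pi fun _ => isCompact_stdSimplex ℝ A)
    (fun P _ => (hcontp P).upperSemicontinuous.upperSemicontinuousOn _)
    (fun P _ => ((hlinp P).mk' _ |>.concaveOn hconvY).quasiconcaveOn)
  have hp' : ∀ s, p s ∈ stdSimplex ℝ A := fun s => hp s trivial
  obtain ⟨M, hMU, hM⟩ := htract.exists_forall_lookahead_le hcompact hr hγ0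
    (fun s => ⟨p s, hp' s⟩) u
  -- `α` is a best reply to `P`, played as a pure policy.
  choose α hα using fun s => Finite.exists_max fun a => ∑ s', P.1 s a s' * (r s a s' + γ * u s')
  have hle : ∀ s, lookahead r γ u (p s) (M.1 s) s ≤
      ∑ s', P.1 s (α s) s' * (r s (α s) s' + γ * u s') := fun s =>
    (hM P hP s).trans (lookahead_le_of_forall_le (hp' s) (hα s))
  have hsum := hsaddle M.1 ⟨M, hMU, rfl⟩ _ (hpure α)
  have hsingle : ∀ s, lookahead r γ u (Pi.single (α s) 1) (P.1 s) s =
      ∑ s', P.1 s (α s) s' * (r s (α s) s' + γ * u s') := fun s => by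
    simp [lookahead, Pi.single_apply]
  simp only [hf, hsingle] at hsum
  have heq := (Finset.sum_eq_sum_iff_of_le fun s _ => hle s).1
    (le_antisymm (Finset.sum_le_sum fun s _ => hle s) hsum)
  exact ⟨_, fun s => ⟨p s, hp' s⟩, P, hP,
    fun P' hP' s => (heq s (Finset.mem_univ s)).symm.trans_le (hM P' hP' s), hα⟩

/-- The robust optimality equation has a solution. -/
theorem WeaklySTractable.exists_isStatewiseSaddle_self [Nonempty S] [Nonempty A]
    (htract : WeaklySTractable U) (hcompact : IsCompact U)
    (hconvex : Convex ℝ ((fun P : TransitionProb S A => P.1) '' U))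
    {r : S → A → S → ℝ} (hr : NextStateIndependent r) {γ : ℝ} (hγ0 : 0 ≤ γ) (hγ1 : γ < 1) :
    ∃ u π P, IsStatewiseSaddle U r γ u u π P := by
  choose T π P hT using fun u =>
    htract.exists_isStatewiseSaddle hcompact hconvex hr hγ0 u
  have hcontr : ContractingWith ⟨γ, hγ0⟩ T := by
    refine ⟨by exact_mod_cast hγ1, LipschitzWith.of_dist_le_mul fun u u' => ?_⟩
    have hc : ∀ u u' : S → ℝ, ∀ s, u s ≤ u' s + dist u u' := fun u u' s => by
      have := (le_abs_self _).trans ((Real.dist_eq _ _).symm.trans_le (dist_le_pi_dist u u' s))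
      linarith
    refine (dist_pi_le_iff (by positivity)).2 fun s => ?_
    rw [Real.dist_eq, abs_le]
    have h₁ := (hT u).le_add hγ0 (hT u') (hc u u') s
    have h₂ := (hT u').le_add hγ0 (hT u) (hc u' u) s
    rw [dist_comm] at h₂
    change -(γ * _) ≤ _ ∧ _ ≤ γ * _
    constructor <;> linarith
  have hfix : T (hcontr.fixedPoint T) = hcontr.fixedPoint T := hcontr.fixedPoint_isFixedPt
  exact ⟨_, _, _, hfix ▸ hT (hcontr.fixedPoint T)⟩

end Tractable

end RobustMDP

theorem mainTheorem10 {S A : Type*} [Fintype S] [Fintype A]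
    [MeasurableSpace S] [MeasurableSpace A]
    [MeasurableSingletonClass S] [MeasurableSingletonClass A]
    (U : Set (RobustMDP.TransitionProb S A))
    (hcompact : IsCompact U)
    (hconvex : Convex ℝ ((fun P : RobustMDP.TransitionProb S A => P.1) '' U))
    (htract : RobustMDP.WeaklySTractable U)
    (r : S → A → S → ℝ) (hr : RobustMDP.NextStateIndependent r)
    (γ : ℝ) (hγ0 : 0 ≤ γ) (hγ1 : γ < 1)
    (μ : S → ℝ) (hμ : μ ∈ stdSimplex ℝ S) :
    (∀ π : RobustMDP.Policy S A, ∃ P ∈ U, ∀ P' ∈ U,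
      RobustMDP.expectedReturn r γ μ π P.toHist ≤ RobustMDP.expectedReturn r γ μ π P'.toHist) ∧
    (⨆ π : RobustMDP.Policy S A, ⨅ Q ∈ RobustMDP.historyAdversaries U,
        (RobustMDP.expectedReturn r γ μ π Q : EReal)) =
      ⨆ π : RobustMDP.Policy S A, ⨅ P ∈ U,
        (RobustMDP.expectedReturn r γ μ π P.toHist : EReal) := by
  have hS : Nonempty S := by
    by_contra h
    rw [not_nonempty_iff] at h
    simpa using hμ.2
  refine ⟨fun π => ?_, le_antisymm ?_ ?_⟩
  · obtain ⟨P, hP, hmin⟩ := hcompact.exists_isMinOn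
      (htract.nonempty fun s => π 0 (Fin.elim0, s))
      (RobustMDP.continuous_expectedReturn hγ0 hγ1 (r := r) μ π).continuousOn
    exact ⟨P, hP, fun P' hP' => hmin hP'⟩
  · exact iSup_mono fun π => le_iInf₂ fun P hP => iInf₂_le P.toHist fun _ _ => hP
  · refine iSup_le fun π => ?_
    -- The existence of a policy excludes the empty action set.
    have hA : Nonempty A := by
      by_contra h
      rw [not_nonempty_iff] at h
      simpa using (π 0 (Fin.elim0, Classical.arbitrary S)).2.2
    obtain ⟨u, π₀, P₀, h⟩ :=
      htract.exists_isStatewiseSaddle_self hcompact hconvex hr hγ0 hγ1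
    refine (iInf₂_le P₀ h.mem).trans (le_iSup_of_le π₀.toPolicy (le_iInf₂ fun Q hQ => ?_))
    refine EReal.coe_le_coe_iff.2 (Finset.sum_le_sum fun s _ =>
      mul_le_mul_of_nonneg_left ((?_ : _ ≤ u s).trans ?_) (hμ.1 s))
    · exact RobustMDP.value_le hγ0 hγ1 (fun n x =>
        RobustMDP.lookahead_le_of_forall_le (π n x).2 (h.action_le x.2)) s
    · exact RobustMDP.le_value hγ0 hγ1 (fun n x => h.le_lookahead _ (hQ n x) x.2) s
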